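/- \textbf{Conventions.} Ordinals are identified with the sets of their predecessors and cardinals with initial ordinals; $[X]^n$ is the set of $n$-element subsets of $X$, and $[X]^\sigma$ the set of subsets of $X$ of size $\sigma$. $E^\lambda_\mu:=\{\alpha<\lambda\mid \mathrm{cf}(\alpha)=\mu\}$. A stationary set $S\subseteq\lambda$ is \emph{nonreflecting} if $S\cap\delta$ is nonstationary in $\delta$ for every $\delta<\lambda$ of uncountable cofinality. A coloring $\varrho:[\kappa]^2\to\lambda$ is \emph{subadditive} if for all $\alpha<\beta<\gamma<\kappa$: $\varrho(\alpha,\gamma)\le\max\{\varrho(\alpha,\beta),\varrho(\beta,\gamma)\}$ and $\varrho(\alpha,\beta)\le\max\{\varrho(\alpha,\gamma),\varrho(\beta,\gamma)\}$. A coloring $d:[\lambda]^2\to\lambda$ \emph{witnesses} $\mathrm{U}(\lambda,\lambda,\lambda,3)$ if for every $\sigma<3$, every pairwise disjoint $\mathcal A\subseteq[\lambda]^\sigma$ of size $\lambda$ and every $\tau<\lambda$, there is $\mathcal B\subseteq\mathcal A$ of size $\lambda$ such that $d(\{\alpha,\beta\})>\tau$ for all $a\ne b$ in $\mathcal B$,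 $\alpha\in a$, $\beta\in b$. For $X\subseteq\kappa$ of order type $\lambda$, $\varrho\restriction[X]^2$ \emph{witnesses} $\mathrm{U}(\lambda,\lambda,\lambda,3)$ if $d(\{\alpha,\beta\}):=\varrho(\{\pi(\alpha),\pi(\beta)\})$ does, where $\pi:\lambda\to X$ is the order-preserving bijection. For a cardinal $\nu$ and an ordinal $\theta$, $\mathcal T(\nu,\theta)$ is the collection of all $T\subseteq{}^{<\theta}\nu$ that are closed under restrictions and all of whose levels $T\cap{}^\alpha\nu$ ($\alpha<\theta$) are nonempty and of size $<\nu$; a branch through $T$ is a $b\in{}^\theta\nu$ with $b\restriction\alpha\in T$ for all $\alpha<\theta$. A \emph{weak $\mu$-Kurepa tree} is a $T$ that belongs to $\mathcal T(\nu,\mu)$ for some cardinal $\nu$, with $|T|=\mu$ and with more than $\mu$ branches. \textbf{Theorem.} Suppose that: \begin{itemize} \item $\mu<\lambda<\kappa$ are infinite regular cardinals; \item there is a nonreflecting stationary subset of $\lambda$ that is contained in $E^\lambda_\mu$; \item $\varrho:[\kappa]^2\to\lambda$ is a subadditive coloring; \item there exists a weak $\mu$-Kurepa tree with at least $\kappa$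 many branches. \end{itemize} Then there exists a coloring $c:[\kappa]^3\to\lambda$ such that for every $\tau<\lambda$ and all disjoint $A,B\subseteq\kappa$ satisfying \begin{enumerate} \item[(i)] $\mathrm{otp}(A)=\mathrm{otp}(B)=\lambda$, \item[(ii)] $\sup(A)=\sup(B)$, \item[(iii)] $\varrho\restriction[A\cup B]^2$ witnesses $\mathrm{U}(\lambda,\lambda,\lambda,3)$, \end{enumerate} there is $x\in[A\cup B]^3\setminus([A]^3\cup[B]^3)$ with $c(x)=\tau$. -/

import Mathlib

open Cardinal Ordinal Set

universe u

namespace OrdColoring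

/-! ### Sets of ordinals, tuples and colorings -/

/-- The order type of a set of ordinals (it lives one universe up, as the set may be a class). -/
noncomputable def otp (X : Set Ordinal.{u}) : Ordinal.{u + 1} :=
  Ordinal.type (fun x y : X => x < y)

/-- `[X]ⁿ`: the `n`-element subsets of a set of ordinals `X`. -/
def tuples (X : Set Ordinal.{u}) (n : ℕ) : Set (Finset Ordinal.{u}) :=
  {s | (s : Set Ordinal.{u}) ⊆ X ∧ s.card = n}

/-- `c` restricts to a coloring `[κ]ⁿ → θ`. The values of `c` outside of `[κ]ⁿ` are irrelevant. -/
def IsColoring (c : Finset Ordinal.{u} → Ordinal.{u}) (κ : Cardinal.{u}) (n : ℕ)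
    (θ : Cardinal.{u}) : Prop :=
  Set.MapsTo c (tuples (Iio κ.ord) n) (Iio θ.ord)

/-- Subadditivity of a coloring of the pairs of ordinals below `κ`. -/
def IsSubadditive (c : Finset Ordinal.{u} → Ordinal.{u}) (κ : Cardinal.{u}) : Prop :=
  ∀ α β γ : Ordinal.{u}, α < β → β < γ → γ < κ.ord →
    c {α, γ} ≤ max (c {α, β}) (c {β, γ}) ∧ c {α, β} ≤ max (c {α, γ}) (c {β, γ})

/-- `c : [κ]² → θ` witnesses `U(κ, μ, θ, χ)`: for every `σ < χ`, every pairwise disjoint family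
`𝒜 ⊆ [κ]^σ` of size `κ` and every `τ < θ`, there is `ℬ ⊆ 𝒜` of size `μ` such that
`c {α, β} > τ` for all `α ∈ a`, `β ∈ b`, for all `a ≠ b` from `ℬ`. -/
def WitnessesU (c : Finset Ordinal.{u} → Ordinal.{u}) (κ μ θ χ : Cardinal.{u}) : Prop :=
  IsColoring c κ 2 θ ∧
  ∀ σ : Cardinal.{u}, σ < χ → ∀ 𝒜 : Set (Set Ordinal.{u}),
    (∀ a ∈ 𝒜, a ⊆ Iio κ.ord ∧ #a = Cardinal.lift.{u + 1} σ) →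
    𝒜.PairwiseDisjoint id → #𝒜 = Cardinal.lift.{u + 1} κ →
    ∀ τ : Ordinal.{u}, τ < θ.ord →
      ∃ ℬ : Set (Set Ordinal.{u}), ℬ ⊆ 𝒜 ∧ #ℬ = Cardinal.lift.{u + 1} μ ∧
        ∀ a ∈ ℬ, ∀ b ∈ ℬ, a ≠ b → ∀ α ∈ a, ∀ β ∈ b, τ < c {α, β}

/-- `c ↾ [X]²` witnesses `U(κ, μ, θ, χ)`, where `X` is a set of ordinals of order type `κ`:
the pullback of `c` along the order-preserving bijection `π : κ ↔ X` is a witness. -/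
def RestrictionWitnessesU (c : Finset Ordinal.{u} → Ordinal.{u}) (X : Set Ordinal.{u})
    (κ μ θ χ : Cardinal.{u}) : Prop :=
  ∃ π : Ordinal.{u} → Ordinal.{u}, StrictMonoOn π (Iio κ.ord) ∧ π '' Iio κ.ord = X ∧
    WitnessesU (fun s => c (s.image π)) κ μ θ χ

/-! ### Stationary sets -/

/-- `S ∩ δ` is a stationary subset of the ordinal `δ`. -/
def StationaryIn (S : Set Ordinal.{u}) (δ : Ordinal.{u}) : Prop :=
  IsStationary ((↑) ⁻¹' S : Set (Iio δ))

/-- `E^κ_χ`: the ordinals below `κ` of cofinality `χ`. -/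
def ordinalsOfCof (κ χ : Cardinal.{u}) : Set Ordinal.{u} :=
  {α | α < κ.ord ∧ α.cof = χ}

/-- `S` is a nonreflecting stationary subset of `κ`: it is stationary in `κ`, but in no ordinal
below `κ` of uncountable cofinality. -/
def IsNonreflectingStationary (S : Set Ordinal.{u}) (κ : Cardinal.{u}) : Prop :=
  S ⊆ Iio κ.ord ∧ StationaryIn S κ.ord ∧
    ∀ δ : Ordinal.{u}, δ < κ.ord → ℵ₀ < δ.cof → ¬ StationaryIn S δ

/-! ### Trees of sequences -/

/-- A sequence of ordinals, whose domain is an ordinal. -/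
structure OrdSeq : Type (u + 1) where
  /-- the domain of the sequence -/
  dom : Ordinal.{u}
  /-- the values of the sequence -/
  val : Iio dom → Ordinal.{u}

/-- The restriction `t ↾ α`. -/
noncomputable def OrdSeq.restrict (t : OrdSeq.{u}) (α : Ordinal.{u}) : OrdSeq.{u} where
  dom := min α t.dom
  val i := t.val ⟨i.1, lt_of_lt_of_le i.2 (min_le_right α t.dom)⟩

/-- `^αν`: the sequences of length `α` all of whose values are below `ν`. -/
def seqs (ν : Cardinal.{u}) (α : Ordinal.{u}) : Set OrdSeq.{u} :=
  {t | t.dom = α ∧ ∀ i, t.val i < ν.ord}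

/-- `T ∈ 𝒯(ν, θ)`: `T` is a downward-closed subset of `^{<θ}ν`
all of whose levels `T_α`, `α < θ`, are nonempty and of size less than `ν`. -/
def IsTree (ν : Cardinal.{u}) (θ : Ordinal.{u}) (T : Set OrdSeq.{u}) : Prop :=
  (∀ t ∈ T, ∃ α < θ, t ∈ seqs ν α) ∧
  (∀ t ∈ T, ∀ α < θ, t.restrict α ∈ T) ∧
  ∀ α < θ, (T ∩ seqs ν α).Nonempty ∧
    #(T ∩ seqs ν α : Set OrdSeq.{u}) < Cardinal.lift.{u + 1} ν

/-- `ℬ(T)`: the branches `b ∈ ^θν` through a tree `T ∈ 𝒯(ν, θ)`. -/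
def branches (ν : Cardinal.{u}) (θ : Ordinal.{u}) (T : Set OrdSeq.{u}) : Set OrdSeq.{u} :=
  {b | b ∈ seqs ν θ ∧ ∀ α < θ, b.restrict α ∈ T}

/-- `T ∈ 𝒯(ν, μ)` is a weak `μ`-Kurepa tree: a tree of height `μ` and size `μ`
with more than `μ` branches. -/
def IsWeakKurepaTree (μ ν : Cardinal.{u}) (T : Set OrdSeq.{u}) : Prop :=
  IsTree ν μ.ord T ∧ #T = Cardinal.lift.{u + 1} μ ∧
    Cardinal.lift.{u + 1} μ < #(branches ν μ.ord T)

end OrdColoring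

open OrdColoring

namespace OrdColoring

/-! Distinct branches give any two points a splitting level Δ below μ, while ρ gives them an ordinal
below λ. If Δ(p,q) exceeds both Δ(o,p) and Δ(o,q), and ρ(o,p) < ρ(o,q), then the set {o,p,q}
determines o, p and q (`HasColor.unique`), so its color may depend on ξ = ρ(o,p), i = Δ(p,q) and η =
ρ(o,q). The color is found by walking from η down to ξ along ladders that are bounded below each
point of the nonreflecting set S. If δ ∈ S, δ ≤ η, i < μ is large, and ξ < δ is close enough to δ,
the walk first stops at δ and returns the label of δ (`walkColor_eq`). As S splits into λ stationary
sets, each τ can be the label of stationarily many δ.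

It remains to find triples with ρ(o,p) < δ ≤ ρ(o,q), where ρ(o,p) is close to δ and Δ(p,q) is large.
There are at most μ < λ nodes, so by pigeonhole unboundedly many q are typical: at arbitrarily high
levels, a large cone splits off from q exactly there (`UnbddUnder.typical`). Shrink A and B to
distinct cones of one level. If some o in the first cone has ρ(o,·) unbounded on the second, then p
and q come from the second cone by a closure argument. Otherwise o comes from the second cone and p,
q from the first: boundedness keeps ρ(o,p) below δ, and U makes ρ(o,p) and ρ(o,q) large enough. -/

/-- The `φ`-image of `P` is unbounded in `l`. -/
def UnbddUnder (l : Ordinal.{u}) (φ : Ordinal.{u} → Ordinal.{u}) (P : Set Ordinal.{u}) : Prop :=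
  ∀ ξ < l, ∃ x ∈ P, ξ < φ x

/-! ### Unbounded sets and closure points below a regular cardinal -/

section Regular

variable {lam : Cardinal.{u}} (hlam : lam.IsRegular)
include hlam

theorem cof_lift_ord_of_isRegular :
    (Ordinal.lift.{u + 1} lam.ord).cof = Cardinal.lift.{u + 1} lam := by
  rw [← Ordinal.lift_cof, hlam.cof_ord]

theorem exists_bound_of_small {ι : Type (u + 1)} (hι : #ι < Cardinal.lift.{u + 1} lam)
    (f : ι → Ordinal.{u}) (hf : ∀ i, f i < lam.ord) : ∃ b < lam.ord, ∀ i, f i < b := by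
  refine ⟨sSup ((· + 1) '' range f), sSup_add_one_lt_of_lt_cof ?_ ?_, fun i => ?_⟩
  · rw [cof_lift_ord_of_isRegular hlam]
    exact mk_range_le.trans_lt hι
  · rintro _ ⟨i, rfl⟩
    exact hf i
  · refine (lt_add_one (f i)).trans_le (le_csSup ⟨lam.ord, ?_⟩ ⟨_, ⟨i, rfl⟩, rfl⟩)
    rintro _ ⟨_, ⟨j, rfl⟩, rfl⟩
    exact Order.add_one_le_of_lt (hf j)

theorem exists_bound_Iio {a : Ordinal.{u}} (ha : a < lam.ord)
    (f : Ordinal.{u} → Ordinal.{u}) (hf : ∀ i < a, f i < lam.ord) :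
    ∃ b < lam.ord, ∀ i < a, f i < b := by
  have hcard : #(Iio a) < Cardinal.lift.{u + 1} lam := by
    rw [Cardinal.mk_Iio_ordinal, Cardinal.lift_lt]
    exact Cardinal.lt_ord.1 ha
  obtain ⟨b, hb, h⟩ := exists_bound_of_small hlam hcard (fun i => f i) fun i => hf i i.2
  exact ⟨b, hb, fun i hi => h ⟨i, hi⟩⟩

omit hlam in
theorem UnbddUnder.mono {l : Ordinal.{u}} {φ : Ordinal.{u} → Ordinal.{u}} {P Q : Set Ordinal.{u}}
    (hP : UnbddUnder l φ P) (h : P ⊆ Q) : UnbddUnder l φ Q := fun ξ hξ =>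
  let ⟨x, hx, hlt⟩ := hP ξ hξ
  ⟨x, h hx, hlt⟩

/-- Pigeonhole by regularity: bounds for fewer than λ bounded pieces have a common bound below λ. -/
theorem UnbddUnder.exists_of_cover {ι : Type (u + 1)} (hι : #ι < Cardinal.lift.{u + 1} lam)
    {φ : Ordinal.{u} → Ordinal.{u}} {P : Set Ordinal.{u}} (hP : UnbddUnder lam.ord φ P)
    (Q : ι → Set Ordinal.{u}) (hQ : P ⊆ ⋃ i, Q i) : ∃ i, UnbddUnder lam.ord φ (Q i) := by
  by_contra! h
  simp only [UnbddUnder, not_forall, not_exists, not_and, not_lt] at h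
  choose f hf h using h
  obtain ⟨b, hb, hfb⟩ := exists_bound_of_small hlam hι f hf
  obtain ⟨x, hx, hbx⟩ := hP b hb
  obtain ⟨i, hi⟩ := mem_iUnion.1 (hQ hx)
  exact (hbx.trans_le (h i x hi)).not_gt (hfb i)

theorem mk_eq_of_unbddUnder {V : Set Ordinal.{u}} (hV : V ⊆ Iio lam.ord)
    (hunb : UnbddUnder lam.ord id V) : #V = Cardinal.lift.{u + 1} lam := by
  refine le_antisymm ?_ ?_
  · rw [← Cardinal.card_ord lam, ← Cardinal.mk_Iio_ordinal]
    exact mk_le_mk_of_subset hV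
  · by_contra! hlt
    obtain ⟨b, hb, h⟩ := exists_bound_of_small hlam hlt (fun v : V => v.1) fun v => hV v.2
    obtain ⟨v, hv, hbv⟩ := hunb b hb
    exact (h ⟨v, hv⟩).not_gt hbv

/-- Iterating a bounding function ω times stays below λ because λ has uncountable cofinality. -/
theorem exists_closed_point (hunc : ℵ₀ < lam) (G : Ordinal.{u} → Ordinal.{u})
    (hG : ∀ ξ < lam.ord, G ξ < lam.ord) {a : Ordinal.{u}} (ha : a < lam.ord) :
    ∃ δ < lam.ord, a < δ ∧ ∀ ξ < δ, G ξ < δ := by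
  have hlim := isSuccLimit_ord hlam.aleph0_le
  have h (ξ) (hξ : ξ < lam.ord) : ∃ b < lam.ord, ξ < b ∧ ∀ i < ξ, G i < b := by
    obtain ⟨b, hb, h⟩ := exists_bound_Iio hlam hξ G fun i hi => hG i (hi.trans hξ)
    exact ⟨max b (ξ + 1), max_lt hb (hlim.add_one_lt hξ), (lt_add_one ξ).trans_le (le_max_right _ _),
      fun i hi => (h i hi).trans_le (le_max_left _ _)⟩
  choose! g hg hlt hb using h
  have hmem (n : ℕ) : g^[n] a < lam.ord := by
    induction n with
    | zero => exact ha
    | succ n ih => rw [Function.iterate_succ_apply']; exact hg _ ih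
  refine ⟨nfp g a, nfp_lt_ord (by rwa [hlam.cof_ord]) hg ha,
    (hlt a ha).trans_le (iterate_le_nfp g a 1), fun ξ hξ => ?_⟩
  obtain ⟨n, hn⟩ := lt_nfp_iff.1 hξ
  refine (hb _ (hmem n) ξ hn).trans_le ?_
  rw [← Function.iterate_succ_apply' g]
  exact iterate_le_nfp g a _

/-- The closure points of `G` form a club. This is the only form in which stationarity is used
afterwards. -/
theorem StationaryIn.exists_closed_point (hunc : ℵ₀ < lam) {S : Set Ordinal.{u}}
    (hS : StationaryIn S lam.ord) (G : Ordinal.{u} → Ordinal.{u})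
    (hG : ∀ ξ < lam.ord, G ξ < lam.ord) : ∃ δ ∈ S, δ < lam.ord ∧ ∀ ξ < δ, G ξ < δ := by
  have hclub : IsClub {δ : Iio lam.ord | ∀ ξ < δ.1, G ξ < δ} := by
    refine ⟨?_, ?_⟩
    · intro d hd _ _ a ha ξ hξ
      obtain ⟨x, hx, hξx⟩ := (lt_isLUB_iff ha (b := ⟨ξ, hξ.trans a.2⟩)).1 hξ
      exact (hd hx ξ hξx).trans_le (ha.1 hx)
    · intro a
      obtain ⟨δ, hδ, haδ, h⟩ := OrdColoring.exists_closed_point hlam hunc G hG a.2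
      exact ⟨⟨δ, hδ⟩, h, haδ.le⟩
  obtain ⟨δ, hδS, hδ⟩ := hS hclub
  exact ⟨δ, hδS, δ.2, hδ⟩

end Regular

/-- Every closure point of a function on `l` can be found in `S`: a form of stationarity. -/
def MeetsClosed (l : Ordinal.{u}) (S : Set Ordinal.{u}) : Prop :=
  ∀ G : Ordinal.{u} → Ordinal.{u}, (∀ ξ < l, G ξ < l) → ∃ δ ∈ S, δ < l ∧ ∀ ξ < δ, G ξ < δ

/-! ### Ladders and walks -/

/-- A cofinal map from a regular cardinal, turned into a monotone map to it. -/
theorem exists_rank {μ : Cardinal.{u}} {β : Ordinal.{u}} (hβ : β.cof = μ) :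
    ∃ e : Ordinal.{u} → Ordinal.{u}, (∀ ξ η, ξ ≤ η → η < β → e ξ ≤ e η) ∧
      (∀ ξ < β, e ξ < μ.ord) ∧ ∀ i < μ.ord, ∃ Λ < β, ∀ ξ, Λ < ξ → ξ < β → i < e ξ := by
  obtain ⟨f, hf⟩ := exists_isFundamentalSeq (o := β) (a := μ.ord) (by rw [hβ])
  have hex (ξ) (hξ : ξ < β) : ∃ j, ∃ hj : j < μ.ord, ξ ≤ f ⟨j, hj⟩ := by
    obtain ⟨_, ⟨j, rfl⟩, hj⟩ := hf.isCofinal_range ⟨ξ, hξ⟩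
    exact ⟨j, j.2, hj⟩
  -- The rank of `ξ` is the least index at which the fundamental sequence reaches `ξ`.
  refine ⟨fun ξ => sInf {j | ∃ hj : j < μ.ord, ξ ≤ f ⟨j, hj⟩}, fun ξ η h hη => ?_, fun ξ hξ => ?_,
    fun i hi => ⟨f ⟨i, hi⟩, (f ⟨i, hi⟩).2, fun ξ h hξ => ?_⟩⟩
  · obtain ⟨hj, h'⟩ := csInf_mem (hex η hη)
    exact csInf_le' ⟨hj, h.trans h'⟩
  · exact (csInf_mem (hex ξ hξ)).1
  · obtain ⟨hj, h'⟩ := csInf_mem (hex ξ hξ)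
    have := h.trans_le h'
    exact hf.strictMono.lt_iff_lt.1 this

/-- A set `C` of ordinals below `β`, cofinal in `β`, that is bounded below each point of `S`. -/
theorem exists_ladder_at {μ : Cardinal.{u}} (hμ : μ.IsRegular) {S : Set Ordinal.{u}}
    (hS : ∀ δ ∈ S, δ.cof = μ) {β : Ordinal.{u}} (hβ : ℵ₀ < β.cof → ¬ StationaryIn S β) :
    ∃ C ⊆ Iio β, (∀ ξ < β, ∃ c ∈ C, ξ ≤ c) ∧
      ∀ δ ∈ S, δ < β → ∃ Λ < δ, ∀ c ∈ C, c < δ → c ≤ Λ := by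
  have hpos (δ) (hδ : δ ∈ S) : Order.IsSuccLimit δ :=
    one_lt_cof_iff.1 ((hS δ hδ).symm ▸ one_lt_aleph0.trans_le hμ.aleph0_le)
  -- If cf(β) ≤ μ, a fundamental sequence has fewer than μ = cf(δ) terms below `δ`. Otherwise
  -- nonreflection supplies a club in `β` disjoint from `S`; were it unbounded in `δ`, it would
  -- contain `δ`.
  by_cases hle : β.cof ≤ μ
  · obtain ⟨f, hf⟩ := exists_isFundamentalSeq (o := β) rfl
    refine ⟨range fun i => (f i).1, ?_, fun ξ hξ => ?_, fun δ hδ hδβ => ?_⟩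
    · rintro _ ⟨i, rfl⟩
      exact (f i).2
    · obtain ⟨_, ⟨j, rfl⟩, hj⟩ := hf.isCofinal_range ⟨ξ, hξ⟩
      exact ⟨_, ⟨j, rfl⟩, hj⟩
    · obtain ⟨_, ⟨j, rfl⟩, hj⟩ := hf.isCofinal_range ⟨δ, hδβ⟩
      refine ⟨sSup {c | c ∈ range (fun i => (f i).1) ∧ c < δ}, sSup_lt_of_lt_cof ?_ fun i hi => hi.2,
        fun c hc hcδ => le_csSup ⟨δ, fun x hx => hx.2.le⟩ ⟨hc, hcδ⟩⟩
      rw [← Ordinal.lift_cof, hS δ hδ]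
      have hsub : {c | c ∈ range (fun i => (f i).1) ∧ c < δ} ⊆
          (fun i : Iio j.1 => (f ⟨i, mem_Iio.2 (lt_trans i.2 j.2)⟩).1) '' univ := by
        rintro _ ⟨⟨i, rfl⟩, hi⟩
        exact ⟨⟨i, hf.strictMono.lt_iff_lt.1 (lt_of_lt_of_le (b := ⟨δ, hδβ⟩) hi hj)⟩, trivial, rfl⟩
      refine (mk_le_mk_of_subset hsub).trans_lt (mk_image_le.trans_lt ?_)
      rw [mk_univ, Cardinal.mk_Iio_ordinal, Cardinal.lift_lt]
      exact (Cardinal.lt_ord.1 j.2).trans_le hle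
  · have hns := hβ (hμ.aleph0_le.trans_lt (not_le.1 hle))
    obtain ⟨t, ht, hdis⟩ := not_isStationary_iff.1 hns
    refine ⟨Subtype.val '' t, ?_, fun ξ hξ => ?_, fun δ hδ hδβ => ?_⟩
    · rintro _ ⟨i, -, rfl⟩
      exact i.2
    · obtain ⟨c, hc, h⟩ := ht.isCofinal ⟨ξ, hξ⟩
      exact ⟨c, ⟨c, hc, rfl⟩, h⟩
    · by_contra! h
      refine hdis.notMem_of_mem_left (a := ⟨δ, hδβ⟩) hδ
        (ht.isLUB_mem (t := {c ∈ t | c < ⟨δ, hδβ⟩}) (fun x hx => hx.1) ?_ ⟨fun x hx => hx.2.le, ?_⟩)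
      · obtain ⟨_, ⟨c, hc, rfl⟩, hcδ, -⟩ := h 0 (hpos δ hδ).bot_lt
        exact ⟨c, hc, hcδ⟩
      · intro b hb
        by_contra! hbδ
        obtain ⟨_, ⟨c, hc, rfl⟩, hcδ, hlt⟩ := h b.1 hbδ
        exact (hb ⟨hc, hcδ⟩).not_gt hlt

open Classical in
/-- Walk from `β` down to `ξ` along the ladder `C`, stopping at the first point `γ` of `S` at which
`ξ` has rank greater than `i`, and return the color of `γ`. -/
noncomputable def walkColor (C : Ordinal.{u} → Set Ordinal.{u}) (S : Set Ordinal.{u})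
    (e : Ordinal.{u} → Ordinal.{u} → Ordinal.{u}) (h : Ordinal.{u} → Ordinal.{u})
    (ξ i β : Ordinal.{u}) : Ordinal.{u} :=
  if β ∈ S ∧ i < e β ξ then h β
  else if _hlt : sInf {c ∈ C β | ξ ≤ c} < β then
    walkColor C S e h ξ i (sInf {c ∈ C β | ξ ≤ c})
  else 0
termination_by β

theorem walkColor_lt {C : Ordinal.{u} → Set Ordinal.{u}} {S : Set Ordinal.{u}}
    {e : Ordinal.{u} → Ordinal.{u} → Ordinal.{u}} {h : Ordinal.{u} → Ordinal.{u}} {l : Ordinal.{u}}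
    (hl : 0 < l) (hh : ∀ γ, h γ < l) (ξ i β : Ordinal.{u}) : walkColor C S e h ξ i β < l := by
  induction β using WellFoundedLT.induction with
  | ind β ih =>
    rw [walkColor]
    split_ifs with h1 h2
    · exact hh β
    · exact ih _ h2
    · exact hl

/-- For `ξ` above the relevant ladder bounds, the walks from `η` towards `ξ` and towards `δ` take
the same steps until they reach `δ`. The threshold `i₀` absorbs the ranks of `δ` at the finitely
many points of `S` met before, and ranks are monotone, so the walk to `ξ` does not stop there. At
`δ` itself the rank of `ξ` exceeds `i` once `ξ` is close to `δ`. -/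
theorem walkColor_eq {μ : Cardinal.{u}} {l : Ordinal.{u}}
    {C : Ordinal.{u} → Set Ordinal.{u}} {S : Set Ordinal.{u}}
    {e : Ordinal.{u} → Ordinal.{u} → Ordinal.{u}} {h : Ordinal.{u} → Ordinal.{u}}
    (hμ : 0 < μ.ord)
    (hCsub : ∀ β < l, C β ⊆ Iio β) (hCcof : ∀ β < l, ∀ ξ < β, ∃ c ∈ C β, ξ ≤ c)
    (hCS : ∀ β < l, ∀ δ ∈ S, δ < β → ∃ Λ < δ, ∀ c ∈ C β, c < δ → c ≤ Λ)
    (he1 : ∀ β ∈ S, ∀ ξ η, ξ ≤ η → η < β → e β ξ ≤ e β η)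
    (he2 : ∀ β ∈ S, ∀ ξ < β, e β ξ < μ.ord)
    (he3 : ∀ β ∈ S, ∀ i < μ.ord, ∃ Λ < β, ∀ ξ, Λ < ξ → ξ < β → i < e β ξ)
    {δ : Ordinal.{u}} (hδ : δ ∈ S) (η : Ordinal.{u}) (hη : δ ≤ η) (hηl : η < l) :
    ∃ i₀ < μ.ord, ∀ i, i₀ ≤ i → i < μ.ord →
      ∃ Λ < δ, ∀ ξ, Λ < ξ → ξ < δ → walkColor C S e h ξ i η = h δ := by
  classical
  induction η using WellFoundedLT.induction with
  | ind η ih =>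
    obtain rfl | hlt := hη.eq_or_lt
    · refine ⟨0, hμ, fun i _ hi => ?_⟩
      obtain ⟨Λ, hΛ, H⟩ := he3 δ hδ i hi
      refine ⟨Λ, hΛ, fun ξ h1 h2 => ?_⟩
      rw [walkColor, if_pos ⟨hδ, H ξ h1 h2⟩]
    · obtain ⟨Λ₁, hΛ₁, H₁⟩ := hCS η hηl δ hδ hlt
      have hmem := csInf_mem (s := {c ∈ C η | δ ≤ c}) (hCcof η hηl δ hlt)
      set η' := sInf {c ∈ C η | δ ≤ c} with hη'
      have hη'η : η' < η := hCsub η hηl hmem.1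
      obtain ⟨i₁, hi₁, IH⟩ := ih η' hη'η hmem.2 (hη'η.trans hηl)
      refine ⟨max i₁ (if η ∈ S then e η δ else 0), ?_, fun i hi hiμ => ?_⟩
      · split_ifs with hS'
        · exact max_lt hi₁ (he2 η hS' δ hlt)
        · exact max_lt hi₁ hμ
      obtain ⟨Λ₂, hΛ₂, H₂⟩ := IH i ((le_max_left _ _).trans hi) hiμ
      refine ⟨max Λ₁ Λ₂, max_lt hΛ₁ hΛ₂, fun ξ h1 h2 => ?_⟩
      -- No ladder point of `η` lies in [ξ, δ), so both walks take the same next step.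
      have hset : {c ∈ C η | ξ ≤ c} = {c ∈ C η | δ ≤ c} := by
        ext c
        refine and_congr_right fun hc => ⟨fun hξc => ?_, h2.le.trans⟩
        by_contra! hcδ
        exact (((le_max_left _ _).trans_lt h1).trans_le hξc).not_ge (H₁ c hc hcδ)
      rw [walkColor, if_neg, hset, dif_pos hη'η]
      · exact H₂ ξ ((le_max_right _ _).trans_lt h1) h2
      · rintro ⟨hS', h3⟩
        rw [if_pos hS'] at hi
        exact (h3.trans_le (he1 η hS' ξ δ h2.le hlt)).not_ge ((le_max_right _ _).trans hi)

/-! ### Pressing down and splitting a stationary set -/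

section Split

variable {lam : Cardinal.{u}} (hlam : lam.IsRegular)
include hlam

/-- Pressing down: a regressive function is constant on a large set. -/
theorem MeetsClosed.exists_fiber {S : Set Ordinal.{u}} (hS : MeetsClosed lam.ord S)
    (f : Ordinal.{u} → Ordinal.{u}) (hf : ∀ δ ∈ S, f δ < δ) :
    ∃ v < lam.ord, MeetsClosed lam.ord {δ ∈ S | f δ = v} := by
  by_contra! h
  have hlim := isSuccLimit_ord hlam.aleph0_le
  have h' (v) (hv : v < lam.ord) := not_forall.1 (h v hv)
  choose! G hG using h'
  push Not at hG
  -- Diagonal intersection: a closure point δ of the resulting `F` is closed under `G v` for every v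
  -- < δ.
  have key (ξ) (hξ : ξ < lam.ord) : ∃ b < lam.ord, ∀ v ≤ ξ, ∀ ζ ≤ ξ, G v ζ < b := by
    have h1 (v) (hv : v < lam.ord) : ∃ b < lam.ord, ∀ ζ < ξ + 1, G v ζ < b :=
      exists_bound_Iio hlam (hlim.add_one_lt hξ) (G v) fun ζ hζ =>
        (hG v hv).1 ζ (hζ.trans (hlim.add_one_lt hξ))
    choose! b hb hb' using h1
    obtain ⟨c, hc, H⟩ := exists_bound_Iio hlam (hlim.add_one_lt hξ) b fun v hv =>
      hb v (hv.trans (hlim.add_one_lt hξ))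
    exact ⟨c, hc, fun v hv ζ hζ => (hb' v (hv.trans_lt hξ) ζ (Order.lt_add_one_iff.2 hζ)).trans
      (H v (Order.lt_add_one_iff.2 hv))⟩
  choose! F hF hF' using key
  obtain ⟨δ, hδS, hδ, hcl⟩ := hS F hF
  have hv := hf δ hδS
  obtain ⟨ξ, hξ, hle⟩ := (hG (f δ) (hv.trans hδ)).2 δ ⟨hδS, rfl⟩ hδ
  exact hle.not_gt ((hF' (max ξ (f δ)) (max_lt (hξ.trans hδ) (hv.trans hδ)) _ (le_max_right _ _) _
    (le_max_left _ _)).trans (hcl _ (max_lt hξ hv)))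

/-- A stationary set of points of cofinality `μ < λ` splits into `λ` stationary sets. -/
theorem MeetsClosed.exists_partition {μ : Cardinal.{u}} (hμ : μ.IsRegular) (hμlam : μ < lam)
    {S : Set Ordinal.{u}} (hS : MeetsClosed lam.ord S) (hcof : ∀ δ ∈ S, δ.cof = μ) :
    ∃ h : Ordinal.{u} → Ordinal.{u}, (∀ γ, h γ < lam.ord) ∧
      ∀ τ < lam.ord, MeetsClosed lam.ord {δ ∈ S | h δ = τ} := by
  have hlim := isSuccLimit_ord hlam.aleph0_le
  have hfs (δ) (hδ : δ ∈ S) : ∃ f : Ordinal.{u} → Ordinal.{u}, (∀ i < μ.ord, f i < δ) ∧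
      ∀ ξ < δ, ∃ i < μ.ord, ξ ≤ f i := by
    obtain ⟨f, hf⟩ := exists_isFundamentalSeq (o := δ) (a := μ.ord) (by rw [hcof δ hδ])
    refine ⟨fun i => if hi : i ∈ Iio μ.ord then (f ⟨i, hi⟩).1 else 0, fun i hi => ?_, fun ξ hξ => ?_⟩
    · dsimp only
      rw [dif_pos (mem_Iio.2 hi)]
      exact (f ⟨i, hi⟩).2
    · obtain ⟨_, ⟨j, rfl⟩, hj⟩ := hf.isCofinal_range ⟨ξ, hξ⟩
      exact ⟨j, j.2, by dsimp only; rw [dif_pos j.2]; exact hj⟩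
  choose! f hf1 hf2 using hfs
  have hμlim : μ.ord < lam.ord := ord_lt_ord.2 hμlam
  -- One index `i` works for all `ζ`: otherwise the μ many counterexamples are bounded by some `b`,
  -- yet a point of `S` above `b` has a term of its fundamental sequence above `b`.
  obtain ⟨i, hi, H⟩ : ∃ i < μ.ord, ∀ ζ < lam.ord, MeetsClosed lam.ord {δ ∈ S | ζ ≤ f δ i} := by
    by_contra! h
    choose! z hz hG using h
    have hG' (i) (hi : i < μ.ord) := not_forall.1 (hG i hi)
    choose! G hG' using hG'
    push Not at hG'
    obtain ⟨b, hb, hzb⟩ := exists_bound_Iio hlam hμlim z hz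
    have key (ξ) (hξ : ξ < lam.ord) := exists_bound_Iio hlam hμlim (fun i => G i ξ)
      fun i hi => (hG' i hi).1 ξ hξ
    choose! F hF hF' using key
    obtain ⟨δ, hδS, hδ, hcl⟩ := hS (fun ξ => max b (F ξ)) fun ξ hξ => max_lt hb (hF ξ hξ)
    have hδ0 : 0 < δ := cof_pos.1 (by rw [hcof δ hδS]; exact hμ.pos)
    have hbδ : b < δ := (le_max_left _ _).trans_lt (hcl 0 hδ0)
    obtain ⟨i, hi, hle⟩ := hf2 δ hδS b hbδ
    obtain ⟨ξ, hξ, hle'⟩ := (hG' i hi).2 δ ⟨hδS, (hzb i hi).le.trans hle⟩ hδ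
    exact hle'.not_gt
      ((hF' ξ (hξ.trans hδ) i hi).trans ((le_max_right _ _).trans_lt (hcl ξ hξ)))
  -- Pressing down `f · i` yields unboundedly many values with stationary fibers. These values are
  -- then relabelled by λ.
  set V : Set Ordinal.{u} := {v | v < lam.ord ∧ MeetsClosed lam.ord {δ ∈ S | f δ i = v}} with hV
  have hVunb (ζ) (hζ : ζ < lam.ord) : ∃ v ∈ V, ζ ≤ v := by
    obtain ⟨v, hv, hM⟩ := (H ζ hζ).exists_fiber hlam (fun δ => f δ i) fun δ hδ => hf1 δ hδ.1 i hi
    refine ⟨v, ⟨hv, fun G hG => ?_⟩, ?_⟩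
    · obtain ⟨δ, hδ, h⟩ := hM G hG
      exact ⟨δ, ⟨hδ.1.1, hδ.2⟩, h⟩
    · obtain ⟨δ, hδ, -⟩ := hM (fun _ => 0) fun _ _ => hlam.ord_pos
      exact hδ.2 ▸ hδ.1.2
  have hVcard : #V = Cardinal.lift.{u + 1} lam := by
    refine mk_eq_of_unbddUnder hlam (fun v hv => hv.1) fun ζ hζ => ?_
    obtain ⟨v, hv, h⟩ := hVunb (ζ + 1) (hlim.add_one_lt hζ)
    exact ⟨v, hv, Order.add_one_le_iff.1 h⟩
  have heq : #V = #(Iio lam.ord) := by rw [hVcard, Cardinal.mk_Iio_ordinal, Cardinal.card_ord]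
  obtain ⟨g⟩ := Cardinal.eq.1 heq
  classical
  refine ⟨fun γ => if hγ : f γ i ∈ V then g ⟨_, hγ⟩ else 0, fun γ => ?_, fun τ hτ G hG => ?_⟩
  · dsimp only
    split_ifs
    · exact (g _).2
    · exact hlam.ord_pos
  · obtain ⟨δ, hδ, h⟩ := (g.symm ⟨τ, hτ⟩).2.2 G hG
    refine ⟨δ, ⟨hδ.1, ?_⟩, h⟩
    have hmem : f δ i ∈ V := hδ.2 ▸ (g.symm ⟨τ, hτ⟩).2
    have : (⟨f δ i, hmem⟩ : V) = g.symm ⟨τ, hτ⟩ := Subtype.ext hδ.2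
    dsimp only
    rw [dif_pos hmem, this, Equiv.apply_symm_apply]

end Split

/-- A nonreflecting stationary set yields a map that, from `η ≥ δ`, a large index `i < μ` and `ξ < δ`
close to `δ`, recovers a prescribed color for `δ`. -/
theorem IsNonreflectingStationary.exists_walkColor {μ lam : Cardinal.{u}} (hμ : μ.IsRegular)
    (hlam : lam.IsRegular) (hμlam : μ < lam) {S : Set Ordinal.{u}} (hSE : S ⊆ ordinalsOfCof lam μ)
    (hS : IsNonreflectingStationary S lam) :
    ∃ D : Ordinal.{u} → Ordinal.{u} → Ordinal.{u} → Ordinal.{u}, (∀ ξ i η, D ξ i η < lam.ord) ∧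
      ∀ τ < lam.ord, ∀ G : Ordinal.{u} → Ordinal.{u}, (∀ ξ < lam.ord, G ξ < lam.ord) →
        ∃ δ < lam.ord, 0 < δ ∧ (∀ ξ < δ, G ξ < δ) ∧ ∀ η, δ ≤ η → η < lam.ord →
          ∃ i₀ < μ.ord, ∀ i, i₀ ≤ i → i < μ.ord →
            ∃ Λ < δ, ∀ ξ, Λ < ξ → ξ < δ → D ξ i η = τ := by
  have hcof (δ) (hδ : δ ∈ S) : δ.cof = μ := (hSE hδ).2
  have hpos (δ) (hδ : δ ∈ S) : 0 < δ := cof_pos.1 (by rw [hcof δ hδ]; exact hμ.pos)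
  have hM : MeetsClosed lam.ord S := fun G hG =>
    hS.2.1.exists_closed_point hlam (hμ.aleph0_le.trans_lt hμlam) G hG
  obtain ⟨h, hh, hpart⟩ := hM.exists_partition hlam hμ hμlam hcof
  have hC (β) (hβ : β < lam.ord) := exists_ladder_at hμ hcof (hS.2.2 β hβ)
  choose! C hC1 hC2 hC3 using hC
  have he (β) (hβ : β ∈ S) := exists_rank (hcof β hβ)
  choose! e he1 he2 he3 using he
  refine ⟨walkColor C S e h, walkColor_lt hlam.ord_pos hh, fun τ hτ G hG => ?_⟩
  obtain ⟨δ, ⟨hδS, rfl⟩, hδ, hcl⟩ := hpart τ hτ G hG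
  exact ⟨δ, hδ, hpos δ hδS, hcl, fun η h1 h2 =>
    walkColor_eq hμ.ord_pos hC1 hC2 hC3 he1 he2 he3 hδS η h1 h2⟩

/-! ### Branches as threads, and their splitting levels -/

theorem OrdSeq.ext_val {s t : OrdSeq.{u}} (hd : s.dom = t.dom)
    (hv : ∀ x hs ht, s.val ⟨x, hs⟩ = t.val ⟨x, ht⟩) : s = t := by
  obtain ⟨d, v⟩ := s
  obtain ⟨d', v'⟩ := t
  obtain rfl : d = d' := hd
  congr
  funext x
  exact hv x.1 x.2 x.2

theorem OrdSeq.val_congr {s t : OrdSeq.{u}} (h : s = t) (x : Ordinal.{u}) (hs ht) :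
    s.val ⟨x, hs⟩ = t.val ⟨x, ht⟩ := by
  subst h
  rfl

theorem OrdSeq.restrict_restrict (t : OrdSeq.{u}) {i j : Ordinal.{u}} (h : j ≤ i) :
    (t.restrict i).restrict j = t.restrict j := by
  refine OrdSeq.ext_val ?_ fun x hs ht => rfl
  change min j (min i t.dom) = min j t.dom
  rw [← min_assoc, min_eq_left h]

/-- The branches of a weak Kurepa tree, viewed as `κ` threads through a set of `μ` nodes. -/
theorem IsWeakKurepaTree.exists_node {μ ν κ : Cardinal.{u}} (hμ : μ.IsRegular) {T : Set OrdSeq.{u}}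
    (hT : IsWeakKurepaTree μ ν T) (hκ : Cardinal.lift.{u + 1} κ ≤ #(branches ν μ.ord T)) :
    ∃ (N : Type (u + 1)) (node : Ordinal.{u} → Ordinal.{u} → N), #N ≤ Cardinal.lift.{u + 1} μ ∧
      (∀ x < κ.ord, ∀ y < κ.ord, ∀ i < μ.ord, ∀ j ≤ i, node x i = node y i → node x j = node y j) ∧
      ∀ x < κ.ord, ∀ y < κ.ord, x ≠ y → ∃ i < μ.ord, node x i ≠ node y i := by
  rw [← Cardinal.card_ord κ, ← Cardinal.mk_Iio_ordinal, Cardinal.le_def] at hκ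
  obtain ⟨b⟩ := hκ
  obtain ⟨t₀, ht₀⟩ := (hT.1.2.2 0 hμ.ord_pos).1
  classical
  have key (x) (hx : x < κ.ord) (i) (hi : i < μ.ord) : (b ⟨x, hx⟩).1.restrict i ∈ T :=
    (b ⟨x, hx⟩).2.2 i hi
  refine ⟨T, fun x i => if h : x < κ.ord ∧ i < μ.ord then ⟨_, key x h.1 i h.2⟩ else ⟨t₀, ht₀.1⟩,
    hT.2.1.le, fun x hx y hy i hi j hj h => ?_, fun x hx y hy hne => ?_⟩
  · dsimp only at h ⊢
    rw [dif_pos ⟨hx, hi⟩, dif_pos ⟨hy, hi⟩, Subtype.mk.injEq] at h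
    rw [dif_pos ⟨hx, hj.trans_lt hi⟩, dif_pos ⟨hy, hj.trans_lt hi⟩, Subtype.mk.injEq,
      ← OrdSeq.restrict_restrict _ hj, h, OrdSeq.restrict_restrict _ hj]
  · by_contra! h
    refine hne ?_
    have hdx : (b ⟨x, hx⟩).1.dom = μ.ord := (b ⟨x, hx⟩).2.1.1
    have hdy : (b ⟨y, hy⟩).1.dom = μ.ord := (b ⟨y, hy⟩).2.1.1
    have heq : b ⟨x, hx⟩ = b ⟨y, hy⟩ := by
      refine Subtype.ext (OrdSeq.ext_val (hdx.trans hdy.symm) fun z hzx hzy => ?_)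
      -- The value at `z` is first visible in the restriction to `z + 1`, which is still below μ.
      have hz1 : z + 1 < μ.ord :=
        (isSuccLimit_ord hμ.aleph0_le).add_one_lt (lt_of_lt_of_eq hzx hdx)
      have h' := h (z + 1) hz1
      rw [dif_pos ⟨hx, hz1⟩, dif_pos ⟨hy, hz1⟩, Subtype.mk.injEq] at h'
      exact OrdSeq.val_congr h' z (mem_Iio.2 (lt_min (lt_add_one z) hzx))
        (mem_Iio.2 (lt_min (lt_add_one z) hzy))
    exact congrArg Subtype.val (b.injective heq)

/-- The first level below `M` at which the threads of `x` and `y` differ. -/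
noncomputable def splitLevel {N : Type (u + 1)} (M : Ordinal.{u})
    (node : Ordinal.{u} → Ordinal.{u} → N) (x y : Ordinal.{u}) : Ordinal.{u} :=
  sInf {j | j < M ∧ node x j ≠ node y j}

/-- The threads `node x`, for `x < l`, are coherent and pairwise distinct below the level `M`. -/
structure IsThreading {N : Type (u + 1)} (M l : Ordinal.{u})
    (node : Ordinal.{u} → Ordinal.{u} → N) : Prop where
  coherent : ∀ x < l, ∀ y < l, ∀ i < M, ∀ j ≤ i, node x i = node y i → node x j = node y j
  separated : ∀ x < l, ∀ y < l, x ≠ y → ∃ i < M, node x i ≠ node y i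

section Split

variable {N : Type (u + 1)} {M l : Ordinal.{u}} {node : Ordinal.{u} → Ordinal.{u} → N}

theorem splitLevel_comm (x y : Ordinal.{u}) :
    splitLevel M node x y = splitLevel M node y x := by
  simp only [splitLevel, ne_comm]

/-- The infimum of the empty set is 0. Hence a pair whose splitting level exceeds another one
consists of distinct points. -/
theorem splitLevel_self (x : Ordinal.{u}) : splitLevel M node x x = 0 := by
  simp [splitLevel]

theorem splitLevel_le {x y i : Ordinal.{u}} (hi : i < M) (h : node x i ≠ node y i) :
    splitLevel M node x y ≤ i :=
  csInf_le' ⟨hi, h⟩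

theorem node_eq_of_lt_splitLevel {x y j : Ordinal.{u}} (hj : j < M)
    (h : j < splitLevel M node x y) : node x j = node y j := by
  by_contra hne
  exact h.not_ge (splitLevel_le hj hne)

variable (hnd : IsThreading M l node) {x y : Ordinal.{u}} (hx : x < l) (hy : y < l)
include hnd hx hy

theorem IsThreading.splitLevel_mem (hne : x ≠ y) :
    splitLevel M node x y < M ∧ node x (splitLevel M node x y) ≠ node y (splitLevel M node x y) :=
  csInf_mem (hnd.separated x hx y hy hne)

theorem IsThreading.lt_splitLevel (hne : x ≠ y) {i : Ordinal.{u}} (h : node x i = node y i)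
    (hi : i < M) : i < splitLevel M node x y := by
  by_contra! hle
  exact (hnd.splitLevel_mem hx hy hne).2 (hnd.coherent x hx y hy i hi _ hle h)

end Split

/-! ### Rich and typical points -/

section Typical

variable {N : Type (u + 1)} {μ lam : Cardinal.{u}} {node : Ordinal.{u} → Ordinal.{u} → N}

/-- Arbitrarily high below `μ`, the thread of `y` splits off from a cone of `φ`-unboundedly many
elements of `P`. -/
def IsTypical (μ lam : Cardinal.{u}) (node : Ordinal.{u} → Ordinal.{u} → N)
    (φ : Ordinal.{u} → Ordinal.{u}) (P : Set Ordinal.{u}) (y : Ordinal.{u}) : Prop :=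
  ∀ i < μ.ord, ∃ i', i ≤ i' ∧ i' < μ.ord ∧ ∃ t, UnbddUnder lam.ord φ {x ∈ P | node x i' = t} ∧
    ∀ x ∈ P, node x i' = t → splitLevel μ.ord node x y = i'

variable (hμ : μ.IsRegular) (hlam : lam.IsRegular) (hμlam : μ < lam)
  (hN : #N ≤ Cardinal.lift.{u + 1} μ)
include hμ hμlam hN

theorem mk_levels_lt : #(Iio μ.ord × N) < Cardinal.lift.{u + 1} lam := by
  rw [Cardinal.mk_prod, Cardinal.lift_id, Cardinal.lift_id, Cardinal.mk_Iio_ordinal,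
    Cardinal.card_ord]
  refine lt_of_le_of_lt (mul_le_mul_right hN _) ?_
  rw [Cardinal.mul_eq_self (by simpa using hμ.aleph0_le), Cardinal.lift_lt]
  exact hμlam

theorem mk_option_levels_lt : #(Option (Iio μ.ord × N)) < Cardinal.lift.{u + 1} lam := by
  rw [Cardinal.mk_option]
  have h := hμ.aleph0_le.trans hμlam.le
  exact Cardinal.add_lt_of_lt (by simpa using h) (mk_levels_lt hμ hμlam hN)
    (Cardinal.one_lt_aleph0.trans_le (by simpa using h))

include hlam

/-- A point that is not rich lies in a bounded cone. There are fewer than λ cones, so their bounded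
parts cannot exhaust `P`. -/
theorem UnbddUnder.rich {φ : Ordinal.{u} → Ordinal.{u}} {P : Set Ordinal.{u}}
    (hP : UnbddUnder lam.ord φ P) :
    UnbddUnder lam.ord φ
      {y ∈ P | ∀ i < μ.ord, UnbddUnder lam.ord φ {x ∈ P | node x i = node y i}} := by
  have hcov : P ⊆ ⋃ o : Option (Iio μ.ord × N), o.elim
      {y ∈ P | ∀ i < μ.ord, UnbddUnder lam.ord φ {x ∈ P | node x i = node y i}}
      fun k : Iio μ.ord × N => {x ∈ P | node x k.1 = k.2 ∧ ¬ UnbddUnder lam.ord φ {x ∈ P | node x k.1 = k.2}} := by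
    intro x hx
    by_cases hx' : ∀ i < μ.ord, UnbddUnder lam.ord φ {z ∈ P | node z i = node x i}
    · exact mem_iUnion.2 ⟨none, ⟨hx, hx'⟩⟩
    · push Not at hx'
      obtain ⟨i, hi, h⟩ := hx'
      exact mem_iUnion.2 ⟨some (⟨i, hi⟩, node x i), ⟨hx, rfl, h⟩⟩
  obtain ⟨_ | ⟨i, t⟩, h⟩ := hP.exists_of_cover hlam (mk_option_levels_lt hμ hμlam hN) _ hcov
  · exact h
  · obtain ⟨x, ⟨-, -, hx⟩, -⟩ := h 0 hlam.ord_pos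
    exact (hx (h.mono fun x hx => ⟨hx.1, hx.2.1⟩)).elim

/-- Every rich point is typical. Sort the points of its cone at level `i` by where they split from
`y` and by their node there; one class is unbounded. Coherence then makes every point of `P` through
that node split from `y` at the same level. -/
theorem UnbddUnder.typical (hnd : IsThreading μ.ord lam.ord node)
    {φ : Ordinal.{u} → Ordinal.{u}} {P : Set Ordinal.{u}} (hPl : P ⊆ Iio lam.ord)
    (hφ : ∀ x ∈ P, φ x < lam.ord) (hP : UnbddUnder lam.ord φ P) :
    UnbddUnder lam.ord φ {y ∈ P | IsTypical μ lam node φ P y} := by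
  refine (hP.rich hμ hlam hμlam hN (node := node)).mono fun y hy => ⟨hy.1, fun i hi => ?_⟩
  obtain ⟨hyP, hy⟩ := hy
  have hcov : {x ∈ P | node x i = node y i} ⊆ ⋃ o : Option (Iio μ.ord × N), o.elim {y}
      fun k => {x ∈ P | x ≠ y ∧ i ≤ k.1 ∧ splitLevel μ.ord node x y = k.1 ∧ node x k.1 = k.2} := by
    intro x hx
    by_cases hxy : x = y
    · exact mem_iUnion.2 ⟨none, hxy⟩
    · have hlt := hnd.splitLevel_mem (hPl hx.1) (hPl hyP) hxy
      exact mem_iUnion.2 ⟨some (⟨_, hlt.1⟩, node x (splitLevel μ.ord node x y)), hx.1, hxy,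
        (hnd.lt_splitLevel (hPl hx.1) (hPl hyP) hxy hx.2 hi).le, rfl, rfl⟩
  obtain ⟨_ | ⟨⟨i', hi'⟩, t⟩, h⟩ :=
    (hy i hi).exists_of_cover hlam (mk_option_levels_lt hμ hμlam hN) _ hcov
  · obtain ⟨x, rfl, hx⟩ := h (φ y) (hφ y hyP)
    exact absurd hx (lt_irrefl _)
  · obtain ⟨x₀, ⟨hx₀P, hne, hii', hs, ht⟩, -⟩ := h 0 hlam.ord_pos
    dsimp only at hii' hs ht
    refine ⟨i', hii', hi', t, h.mono fun x hx => ⟨hx.1, hx.2.2.2.2⟩, fun x hxP hxt => ?_⟩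
    have hxy : x ≠ y := by
      rintro rfl
      have := (hnd.splitLevel_mem (hPl hx₀P) (hPl hyP) hne).2
      rw [hs] at this
      exact this (ht.trans hxt.symm)
    refine le_antisymm (splitLevel_le hi' ?_) ?_
    · rw [hxt, ← ht, ← hs]
      exact (hnd.splitLevel_mem (hPl hx₀P) (hPl hyP) hne).2
    · by_contra! hlt
      obtain ⟨h1, h2⟩ := hnd.splitLevel_mem (hPl hxP) (hPl hyP) hxy
      refine h2 ((hnd.coherent x (hPl hxP) x₀ (hPl hx₀P) i' hi' _ hlt.le (hxt.trans ht.symm)).trans ?_)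
      exact node_eq_of_lt_splitLevel h1 (hs ▸ hlt)

end Typical

/-! ### Using U on pairs -/

/-- The consequence of `U(λ, λ, λ, 3)` that is used. -/
theorem WitnessesU.exists_lt {lam : Cardinal.{u}} (hlam : lam.IsRegular) (hunc : ℵ₀ < lam)
    {c : Finset Ordinal.{u} → Ordinal.{u}} (hc : WitnessesU c lam lam lam 3) {P : Set Ordinal.{u}}
    (hPl : P ⊆ Iio lam.ord) (hP : UnbddUnder lam.ord id P) (z : Ordinal.{u} → Ordinal.{u})
    (hz : ∀ ε < lam.ord, ε ≤ z ε ∧ z ε < lam.ord) {τ : Ordinal.{u}} (hτ : τ < lam.ord) :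
    ∃ y ∈ P, ∃ ε < lam.ord, y < ε ∧ τ < c {y, z ε} := by
  have hy (ε) (hε : ε < lam.ord) := hP (z ε) (hz ε hε).2
  choose! y hyP hzy using hy
  simp only [id] at hzy
  -- Restricting to closure points of `y` separates the pairs `{y ε, z ε}` into consecutive blocks,
  -- so they are disjoint and U applies with σ = 2. Two members of the resulting family give the
  -- cross pair of `y` at the smaller index and `z` at the larger.
  set E := {ε | ε < lam.ord ∧ ∀ ε' < ε, y ε' < ε} with hE
  set a : Ordinal.{u} → Set Ordinal.{u} := fun ε => {y ε, z ε} with ha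
  have hlow (ε ε') (hε : ε ∈ E) (hε' : ε' ∈ E) (h : ε < ε') (x) (hx : x ∈ a ε) : x < ε' := by
    obtain rfl | rfl := hx
    · exact hε'.2 ε h
    · exact (hzy ε hε.1).trans (hε'.2 ε h)
  have hhigh (ε) (hε : ε ∈ E) (x) (hx : x ∈ a ε) : ε ≤ x := by
    obtain rfl | rfl := hx
    · exact (hz ε hε.1).1.trans (hzy ε hε.1).le
    · exact (hz ε hε.1).1
  have hdisj (ε ε') (hε : ε ∈ E) (hε' : ε' ∈ E) (h : ε < ε') : Disjoint (a ε) (a ε') :=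
    Set.disjoint_left.2 fun x h1 h2 => (hlow ε ε' hε hε' h x h1).not_ge (hhigh ε' hε' x h2)
  have hne (ε) (hε : ε ∈ E) (ε') (hε' : ε' ∈ E) (h : ε ≠ ε') : Disjoint (a ε) (a ε') := by
    obtain h | h := h.lt_or_gt
    · exact hdisj ε ε' hε hε' h
    · exact (hdisj ε' ε hε' hε h).symm
  have hinj : InjOn a E := by
    intro ε hε ε' hε' heq
    by_contra h
    have := hne ε hε ε' hε' h
    rw [← heq, disjoint_self] at this
    exact (Set.insert_nonempty _ _).ne_empty this
  have hEcard : #(a '' E) = Cardinal.lift.{u + 1} lam := by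
    rw [mk_image_eq_of_injOn _ _ hinj]
    refine mk_eq_of_unbddUnder hlam (fun ε hε => hε.1) fun ξ hξ => ?_
    obtain ⟨δ, hδ, h1, h2⟩ := exists_closed_point hlam hunc y (fun ε hε => hPl (hyP ε hε)) hξ
    exact ⟨δ, ⟨hδ, h2⟩, h1⟩
  have hsub : ∀ b ∈ a '' E, b ⊆ Iio lam.ord ∧ #b = Cardinal.lift.{u + 1} (2 : Cardinal.{u}) := by
    rintro _ ⟨ε, hε, rfl⟩
    refine ⟨?_, ?_⟩
    · rintro x (rfl | rfl)
      · exact hPl (hyP ε hε.1)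
      · exact (hz ε hε.1).2
    · rw [ha, Cardinal.mk_insert (by simpa using (hzy ε hε.1).ne'), Cardinal.mk_singleton,
        Cardinal.lift_ofNat, one_add_one_eq_two]
  have hpd : (a '' E).PairwiseDisjoint id := by
    rintro _ ⟨ε, hε, rfl⟩ _ ⟨ε', hε', rfl⟩ h
    exact hne ε hε ε' hε' fun h' => h (h' ▸ rfl)
  have h23 : (2 : Cardinal.{u}) < 3 := by exact_mod_cast (by decide : 2 < 3)
  obtain ⟨ℬ, hℬ, hcard, H⟩ := hc.2 2 h23 (a '' E) hsub hpd hEcard τ hτ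
  have hnt : 1 < #ℬ := by
    rw [hcard, Cardinal.one_lt_lift_iff]
    exact Cardinal.one_lt_aleph0.trans hunc
  obtain ⟨⟨b₁, h₁⟩, ⟨b₂, h₂⟩, hb⟩ := (Cardinal.one_lt_iff_nontrivial.1 hnt).exists_pair_ne
  obtain ⟨ε₁, hε₁, rfl⟩ := hℬ h₁
  obtain ⟨ε₂, hε₂, rfl⟩ := hℬ h₂
  have hb' : a ε₁ ≠ a ε₂ := fun h => hb (Subtype.ext h)
  have hεne : ε₁ ≠ ε₂ := fun h => hb' (h ▸ rfl)
  obtain h | h := hεne.lt_or_gt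
  · exact ⟨y ε₁, hyP _ hε₁.1, ε₂, hε₂.1, hε₂.2 _ h,
      H _ h₁ _ h₂ hb' _ (mem_insert _ _) _ (mem_insert_of_mem _ rfl)⟩
  · exact ⟨y ε₂, hyP _ hε₂.1, ε₁, hε₁.1, hε₁.2 _ h,
      H _ h₂ _ h₁ hb'.symm _ (mem_insert _ _) _ (mem_insert_of_mem _ rfl)⟩

/-! ### Colored triples -/

section Triple

variable {N : Type (u + 1)} {μ lam : Cardinal.{u}} {node : Ordinal.{u} → Ordinal.{u} → N}
  {r : Ordinal.{u} → Ordinal.{u} → Ordinal.{u}}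
  {D : Ordinal.{u} → Ordinal.{u} → Ordinal.{u} → Ordinal.{u}}

/-- The pair `{p, q}` splits above `o`, and the walk from `r o q` to `r o p` has color `τ`. -/
def HasColor (μ : Cardinal.{u}) (node : Ordinal.{u} → Ordinal.{u} → N)
    (r : Ordinal.{u} → Ordinal.{u} → Ordinal.{u})
    (D : Ordinal.{u} → Ordinal.{u} → Ordinal.{u} → Ordinal.{u}) (o p q τ : Ordinal.{u}) : Prop :=
  splitLevel μ.ord node o p < splitLevel μ.ord node p q ∧
    splitLevel μ.ord node o q < splitLevel μ.ord node p q ∧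
    r o p < r o q ∧ D (r o p) (splitLevel μ.ord node p q) (r o q) = τ

/-- The points of `{o, p, q}` that have a color are determined by the set. -/
theorem HasColor.unique {o p q τ o' p' q' τ' : Ordinal.{u}}
    (h : HasColor μ node r D o p q τ) (h' : HasColor μ node r D o' p' q' τ')
    (heq : ({o, p, q} : Finset Ordinal.{u}) = {o', p', q'}) : τ = τ' := by
  obtain ⟨h1, h2, h3, rfl⟩ := h
  obtain ⟨h1', h2', h3', rfl⟩ := h'
  have ho : o' ∈ ({o, p, q} : Finset Ordinal.{u}) := heq ▸ by simp
  have hp : p' ∈ ({o, p, q} : Finset Ordinal.{u}) := heq ▸ by simp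
  have hq : q' ∈ ({o, p, q} : Finset Ordinal.{u}) := heq ▸ by simp
  simp only [Finset.mem_insert, Finset.mem_singleton] at ho hp hq
  have hop := splitLevel_comm (M := μ.ord) (node := node) o p
  have hoq := splitLevel_comm (M := μ.ord) (node := node) o q
  have hpq := splitLevel_comm (M := μ.ord) (node := node) p q
  have hself (x : Ordinal.{u}) (y : Ordinal.{u}) : ¬ y < splitLevel μ.ord node x x := by
    rw [splitLevel_self]
    exact not_lt_zero
  -- The pair with strictly largest splitting level singles out `o`, and the inequality between the
  -- `r`-values orders the other two; all remaining identifications are contradictory.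
  obtain rfl | rfl | rfl := ho <;> obtain rfl | rfl | rfl := hp <;> obtain rfl | rfl | rfl := hq <;>
    first
    | rfl
    | exact absurd h1' (hself _ _)
    | exact absurd h3' (lt_irrefl _)
    | exact absurd h3' h3.not_gt
    | exact absurd h1' (lt_irrefl _)
    | exact absurd h2' (lt_irrefl _)
    | order

/-- Endgame: a typical `y` in the cone `P` with `r o y ≥ δ` can be completed to a triple. -/
theorem exists_hasColor (hnd : IsThreading μ.ord lam.ord node) {P : Set Ordinal.{u}}
    (hP : P ⊆ Iio lam.ord) {o y δ τ i₀ : Ordinal.{u}} {t₀ : N} (hi₀ : i₀ < μ.ord)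
    (ht₀ : ∀ x ∈ P, node x i₀ = t₀) (hot : node o i₀ ≠ t₀) (hy : y ∈ P) (hδ : δ ≤ r o y)
    (hD : ∃ i₁ < μ.ord, ∀ i, i₁ ≤ i → i < μ.ord →
      ∃ Λ < δ, ∀ ξ, Λ < ξ → ξ < δ → D ξ i (r o y) = τ)
    {φ : Ordinal.{u} → Ordinal.{u}} (htyp : IsTypical μ lam node φ P y)
    (H : ∀ i < μ.ord, ∀ t, UnbddUnder lam.ord φ {x ∈ P | node x i = t} →
      ∀ ξ < δ, ∃ x ∈ P, node x i = t ∧ ξ < r o x ∧ r o x < δ) :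
    ∃ p ∈ P, HasColor μ node r D o p y τ := by
  -- The order of choices matters: `r o y` fixes the threshold `i₁`, typicality then gives a level
  -- `i` above it, this level determines `Λ`, and only then is `p` chosen with `r o p` between `Λ`
  -- and `δ`.
  obtain ⟨i₁, hi₁, hD⟩ := hD
  obtain ⟨i, hi, hiμ, t, ht, hsplit⟩ := htyp i₁ hi₁
  obtain ⟨Λ, hΛ, hD⟩ := hD i hi hiμ
  obtain ⟨p, hp, hpt, hΛp, hpδ⟩ := H i hiμ t ht Λ hΛ
  have hlt : r o p < r o y := hpδ.trans_le hδ
  have hpy : p ≠ y := fun h => hlt.ne (h ▸ rfl)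
  have hbig : i₀ < splitLevel μ.ord node p y :=
    hnd.lt_splitLevel (hP hp) (hP hy) hpy ((ht₀ p hp).trans (ht₀ y hy).symm) hi₀
  refine ⟨p, hp, (splitLevel_le hi₀ ?_).trans_lt hbig, (splitLevel_le hi₀ ?_).trans_lt hbig, hlt, ?_⟩
  · rwa [ht₀ p hp]
  · rwa [ht₀ y hy]
  · rw [hsplit p hp hpt]
    exact hD _ hΛp hpδ

variable (hμ : μ.IsRegular) (hlam : lam.IsRegular) (hμlam : μ < lam)
  (hN : #N ≤ Cardinal.lift.{u + 1} μ)
include hμ hlam hμlam hN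

/-- For a family of functions indexed by the levels and nodes, there is a common bound. -/
theorem exists_uniform_bound (f : Ordinal.{u} → N → Ordinal.{u} → Ordinal.{u})
    (hf : ∀ i < μ.ord, ∀ t, ∀ ξ < lam.ord, f i t ξ < lam.ord) :
    ∃ G : Ordinal.{u} → Ordinal.{u}, (∀ ξ < lam.ord, G ξ < lam.ord) ∧
      ∀ ξ < lam.ord, ∀ i < μ.ord, ∀ t, f i t ξ < G ξ := by
  have h (ξ) (hξ : ξ < lam.ord) := exists_bound_of_small hlam (mk_levels_lt hμ hμlam hN)
    (fun k => f k.1 k.2 ξ) fun k => hf k.1 k.1.2 k.2 ξ hξ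
  choose! G hG hG' using h
  exact ⟨G, hG, fun ξ hξ i hi t => hG' ξ hξ (⟨i, hi⟩, t)⟩

variable (hnd : IsThreading μ.ord lam.ord node)
include hnd

/-- Two unbounded sets can be refined to lie in distinct cones of the same level. -/
theorem exists_distinct_cones {A B : Set Ordinal.{u}} (hAl : A ⊆ Iio lam.ord)
    (hA : UnbddUnder lam.ord id A) (hB : UnbddUnder lam.ord id B) :
    ∃ i < μ.ord, ∃ s t, s ≠ t ∧ UnbddUnder lam.ord id {x ∈ A | node x i = s} ∧
      UnbddUnder lam.ord id {x ∈ B | node x i = t} := by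
  have hrich := hA.rich hμ hlam hμlam hN (node := node)
  obtain ⟨x, ⟨hxA, hx⟩, -⟩ := hrich 0 hlam.ord_pos
  obtain ⟨y, ⟨hyA, hy⟩, hxy⟩ := hrich x (hAl hxA)
  obtain ⟨i, hi, hne⟩ := hnd.separated x (hAl hxA) y (hAl hyA) (ne_of_lt hxy)
  obtain ⟨z, ⟨-, hz⟩, -⟩ := hB.rich hμ hlam hμlam hN (node := node) 0 hlam.ord_pos
  by_cases h : node x i = node z i
  -- Since `x` and `y` differ at level `i`, the node of `z` there differs from at least one of
  -- theirs.
  · exact ⟨i, hi, _, _, fun h' => hne (h.trans h'.symm), hy i hi, hz i hi⟩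
  · exact ⟨i, hi, _, _, h, hx i hi, hz i hi⟩

variable (hr : ∀ x y, r x y = r y x)
  (hrl : ∀ x < lam.ord, ∀ y < lam.ord, x ≠ y → r x y < lam.ord)
  {τ : Ordinal.{u}}
  (hD : ∀ G : Ordinal.{u} → Ordinal.{u}, (∀ ξ < lam.ord, G ξ < lam.ord) →
    ∃ δ < lam.ord, 0 < δ ∧ (∀ ξ < δ, G ξ < δ) ∧ ∀ η, δ ≤ η → η < lam.ord →
      ∃ i₀ < μ.ord, ∀ i, i₀ ≤ i → i < μ.ord → ∃ Λ < δ, ∀ ξ, Λ < ξ → ξ < δ → D ξ i η = τ)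
include hrl hD

/-- Here largeness is measured by `r o`. Closing `δ` under witnesses for all large cones puts values
of `r o` from each such cone cofinally below `δ`, while a typical `q` has `r o q` above `δ`. -/
theorem exists_hasColor_of_unbounded {Q : Set Ordinal.{u}} (hQ : Q ⊆ Iio lam.ord)
    {o i₀ : Ordinal.{u}} {t₀ : N} (ho : o < lam.ord) (hi₀ : i₀ < μ.ord)
    (ht₀ : ∀ x ∈ Q, node x i₀ = t₀) (hot : node o i₀ ≠ t₀)
    (hunb : UnbddUnder lam.ord (r o) Q) :
    ∃ p ∈ Q, ∃ q ∈ Q, HasColor μ node r D o p q τ := by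
  have hro (x) (hx : x ∈ Q) : r o x < lam.ord :=
    hrl o ho x (hQ hx) fun h => hot (h ▸ ht₀ x hx)
  have key (i) (t) (ξ) (hξ : ξ < lam.ord) :
      ∃ v < lam.ord, UnbddUnder lam.ord (r o) {x ∈ Q | node x i = t} →
        ∃ x ∈ Q, node x i = t ∧ ξ < r o x ∧ r o x = v := by
    by_cases h : UnbddUnder lam.ord (r o) {x ∈ Q | node x i = t}
    · obtain ⟨x, ⟨hx, hxt⟩, hlt⟩ := h ξ hξ
      exact ⟨r o x, hro x hx, fun _ => ⟨x, hx, hxt, hlt, rfl⟩⟩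
    · exact ⟨0, hlam.ord_pos, fun h' => absurd h' h⟩
  choose! f hf hf' using key
  obtain ⟨G, hG, hfG⟩ := exists_uniform_bound hμ hlam hμlam hN f fun i _ t ξ hξ => hf i t ξ hξ
  obtain ⟨δ, hδ, -, hcl, hDδ⟩ := hD G hG
  obtain ⟨y, ⟨hyQ, hy⟩, hδy⟩ := hunb.typical hμ hlam hμlam hN hnd hQ hro δ hδ
  have H : ∀ i < μ.ord, ∀ t, UnbddUnder lam.ord (r o) {x ∈ Q | node x i = t} →
      ∀ ξ < δ, ∃ x ∈ Q, node x i = t ∧ ξ < r o x ∧ r o x < δ := by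
    intro i hi t ht ξ hξ
    obtain ⟨x, hx, hxt, hlt, hxf⟩ := hf' i t ξ (hξ.trans hδ) ht
    refine ⟨x, hx, hxt, hlt, ?_⟩
    rw [hxf]
    exact (hfG ξ (hξ.trans hδ) i hi t).trans (hcl ξ hξ)
  obtain ⟨p, hp, h⟩ := exists_hasColor hnd hQ hi₀ ht₀ hot hyQ hδy.le
    (hDδ _ hδy.le (hro y hyQ)) hy H
  exact ⟨p, hp, y, hyQ, h⟩

include hr

/-- No single `o` is available in advance, so `δ` must serve all `o ∈ Q` above it. Largeness is
measured by position, U gives the lower bounds on `r`, and `hb` gives the upper ones. -/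
theorem exists_hasColor_of_bounded {P Q : Set Ordinal.{u}} (hP : P ⊆ Iio lam.ord)
    (hQ : Q ⊆ Iio lam.ord) (hPunb : UnbddUnder lam.ord id P) (hQunb : UnbddUnder lam.ord id Q)
    {i₀ : Ordinal.{u}} {s₀ t₀ : N} (hi₀ : i₀ < μ.ord) (hst : s₀ ≠ t₀)
    (hs₀ : ∀ x ∈ P, node x i₀ = s₀) (ht₀ : ∀ x ∈ Q, node x i₀ = t₀)
    (hU : ∀ P' ⊆ Iio lam.ord, UnbddUnder lam.ord id P' → ∀ z : Ordinal.{u} → Ordinal.{u},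
      (∀ ε < lam.ord, ε ≤ z ε ∧ z ε < lam.ord) → ∀ τ < lam.ord,
        ∃ y ∈ P', ∃ ε < lam.ord, y < ε ∧ τ < r y (z ε))
    (hb : ∀ x ∈ P, ¬ UnbddUnder lam.ord (r x) Q) :
    ∃ o ∈ Q, ∃ p ∈ P, ∃ q ∈ P, HasColor μ node r D o p q τ := by
  have key (i) (t) (ξ) (hξ : ξ < lam.ord) :
      ∃ v < lam.ord, UnbddUnder lam.ord id {x ∈ P | node x i = t} →
        ∀ z ∈ Q, v ≤ z → ∃ x ∈ P, node x i = t ∧ x < v ∧ ξ < r x z := by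
    by_cases h : UnbddUnder lam.ord id {x ∈ P | node x i = t}
    -- Failure for every `v` yields points `z v ∈ Q` above `v` with `r x (z v) ≤ ξ` for all earlier
    -- `x` in the cone, against U.
    · by_contra! hcon
      have hcon' (v) (hv : v < lam.ord) := (hcon v hv).2
      choose! z hzQ hvz hz using hcon'
      obtain ⟨y, ⟨hyP, hyt⟩, ε, hε, hyε, hlt⟩ :=
        hU _ (fun x hx => hP hx.1) h z (fun ε hε => ⟨hvz ε hε, hQ (hzQ ε hε)⟩) ξ hξ
      exact (hz ε hε y hyP hyt hyε).not_gt hlt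
    · exact ⟨0, hlam.ord_pos, fun h' => absurd h' h⟩
  choose! f hf hf' using key
  obtain ⟨G, hG, hfG⟩ := exists_uniform_bound hμ hlam hμlam hN f fun i _ t ξ hξ => hf i t ξ hξ
  have hb' (x) (hx : x < lam.ord) : ∃ g < lam.ord, x ∈ P → ∀ z ∈ Q, r x z ≤ g := by
    by_cases hxP : x ∈ P
    · have h := hb x hxP
      simp only [UnbddUnder, not_forall, not_exists, not_and, not_lt] at h
      obtain ⟨g, hg, h⟩ := h
      exact ⟨g, hg, fun _ => h⟩
    · exact ⟨0, hlam.ord_pos, fun h' => absurd h' hxP⟩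
  choose! g hg hg' using hb'
  obtain ⟨δ, hδ, -, hcl, hDδ⟩ := hD (fun ξ => max (G ξ) (g ξ)) fun ξ hξ => max_lt (hG ξ hξ) (hg ξ hξ)
  have hz (ε) (hε : ε < lam.ord) := hQunb ε hε
  choose! z hzQ hz using hz
  have htyp := hPunb.typical hμ hlam hμlam hN hnd hP fun x hx => hP hx
  obtain ⟨y, ⟨⟨hyP, hy⟩, hδy⟩, ε, hε, hyε, hlt⟩ :=
    hU {y ∈ {y ∈ P | IsTypical μ lam node id P y} | δ < y} (fun x hx => hP hx.1.1)
      (fun ξ hξ => by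
        obtain ⟨x, hx, hlt⟩ := htyp (max ξ δ) (max_lt hξ hδ)
        exact ⟨x, ⟨hx, (le_max_right _ _).trans_lt hlt⟩, (le_max_left _ _).trans_lt hlt⟩)
      z (fun ε hε => ⟨(hz ε hε).le, hQ (hzQ ε hε)⟩) δ hδ
  have hoQ := hzQ ε hε
  have hδz : δ < z ε := hδy.trans (hyε.trans (hz ε hε))
  have hot : node (z ε) i₀ ≠ s₀ := by
    rw [ht₀ _ hoQ]
    exact hst.symm
  have hry : r (z ε) y < lam.ord :=
    hrl _ (hQ hoQ) _ (hP hyP) fun h => hot (h ▸ hs₀ y hyP)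
  have hδry : δ ≤ r (z ε) y := by
    rw [hr]
    exact hlt.le
  have H : ∀ i < μ.ord, ∀ t, UnbddUnder lam.ord id {x ∈ P | node x i = t} →
      ∀ ξ < δ, ∃ x ∈ P, node x i = t ∧ ξ < r (z ε) x ∧ r (z ε) x < δ := by
    intro i hi t ht ξ hξ
    have hfδ : f i t ξ < δ :=
      (hfG ξ (hξ.trans hδ) i hi t).trans ((le_max_left _ _).trans_lt (hcl ξ hξ))
    obtain ⟨x, hxP, hxt, hxf, hlt'⟩ := hf' i t ξ (hξ.trans hδ) ht _ hoQ (hfδ.trans hδz).le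
    refine ⟨x, hxP, hxt, hr _ _ ▸ hlt', ?_⟩
    rw [hr]
    exact (hg' x (hP hxP) hxP _ hoQ).trans_lt
      ((le_max_right _ _).trans_lt (hcl x (hxf.trans hfδ)))
  obtain ⟨p, hp, h⟩ := exists_hasColor hnd hP hi₀ hs₀ hot hyP hδry (hDδ _ hδry hry) hy H
  exact ⟨_, hoQ, p, hp, y, hyP, h⟩

/-- Of any two unbounded sets `A` and `B`, one contains two points and the other one point of a
triple of color `τ`. -/
theorem exists_mixed_hasColor {A B : Set Ordinal.{u}} (hA : A ⊆ Iio lam.ord) (hB : B ⊆ Iio lam.ord)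
    (hAunb : UnbddUnder lam.ord id A) (hBunb : UnbddUnder lam.ord id B)
    (hU : ∀ P' ⊆ Iio lam.ord, UnbddUnder lam.ord id P' → ∀ z : Ordinal.{u} → Ordinal.{u},
      (∀ ε < lam.ord, ε ≤ z ε ∧ z ε < lam.ord) → ∀ τ < lam.ord,
        ∃ y ∈ P', ∃ ε < lam.ord, y < ε ∧ τ < r y (z ε)) :
    ∃ o p q, (o ∈ A ∧ p ∈ B ∧ q ∈ B ∨ o ∈ B ∧ p ∈ A ∧ q ∈ A) ∧ HasColor μ node r D o p q τ := by
  obtain ⟨i₀, hi₀, s₀, t₀, hst, hPunb, hQunb⟩ :=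
    exists_distinct_cones hμ hlam hμlam hN hnd hA hAunb hBunb
  by_cases h : ∃ o ∈ {x ∈ A | node x i₀ = s₀}, UnbddUnder lam.ord (r o) {x ∈ B | node x i₀ = t₀}
  · obtain ⟨o, ho, hunb⟩ := h
    obtain ⟨p, hp, q, hq, hc⟩ := exists_hasColor_of_unbounded hμ hlam hμlam hN hnd hrl hD
      (fun x hx => hB hx.1) (hA ho.1) hi₀ (fun x hx => hx.2) (by rwa [ho.2]) hunb
    exact ⟨o, p, q, Or.inl ⟨ho.1, hp.1, hq.1⟩, hc⟩
  · push Not at h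
    obtain ⟨o, ho, p, hp, q, hq, hc⟩ := exists_hasColor_of_bounded hμ hlam hμlam hN hnd hr hrl hD
      (fun x hx => hA hx.1) (fun x hx => hB hx.1) hPunb hQunb hi₀ hst (fun x hx => hx.2)
      (fun x hx => hx.2) hU h
    exact ⟨o, p, q, Or.inr ⟨ho.1, hp.1, hq.1⟩, hc⟩

end Triple

/-! ### Pulling back to λ, and the final coloring -/

/-- A subset of the image of `Iio λ` under a strictly monotone map that has order type `λ` pulls back
to an unbounded set. -/
theorem unbddUnder_of_otp {lam : Cardinal.{u}} (hlam : lam.IsRegular)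
    {π : Ordinal.{u} → Ordinal.{u}} {X A : Set Ordinal.{u}} (hX : π '' Iio lam.ord = X) (hA : A ⊆ X)
    (hotp : otp A = Ordinal.lift.{u + 1} lam.ord) :
    UnbddUnder lam.ord id {x | x < lam.ord ∧ π x ∈ A} := by
  by_contra! h
  simp only [UnbddUnder, not_forall, not_exists, not_and, not_lt] at h
  obtain ⟨b, hb, h⟩ := h
  have hsub : A ⊆ π '' Iio (b + 1) := by
    intro a ha
    obtain ⟨x, hx, rfl⟩ := hX ▸ hA ha
    exact ⟨x, Order.lt_add_one_iff.2 (h x ⟨hx, ha⟩), rfl⟩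
  have hcard : #A = Cardinal.lift.{u + 1} lam := by
    have := congrArg Ordinal.card hotp
    rwa [← Ordinal.lift_card, Cardinal.card_ord] at this
  have hlt : #A < Cardinal.lift.{u + 1} lam := by
    refine ((mk_le_mk_of_subset hsub).trans mk_image_le).trans_lt ?_
    rw [Cardinal.mk_Iio_ordinal, Cardinal.lift_lt]
    exact Cardinal.lt_ord.1 ((isSuccLimit_ord hlam.aleph0_le).add_one_lt hb)
  exact hlt.ne hcard

end OrdColoring

open OrdColoring
theorem mainTheorem5 (μ lam κ : Cardinal.{u})
    (hμ : μ.IsRegular) (hlam : lam.IsRegular) (hκ : κ.IsRegular)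
    (hμlam : μ < lam) (hlamκ : lam < κ)
    (hE : ∃ S ⊆ ordinalsOfCof lam μ, IsNonreflectingStationary S lam)
    (ρ : Finset Ordinal.{u} → Ordinal.{u})
    (hρ : IsColoring ρ κ 2 lam) (hρsub : IsSubadditive ρ κ)
    (hT : ∃ (ν : Cardinal.{u}) (T : Set OrdSeq.{u}), IsWeakKurepaTree μ ν T ∧
      Cardinal.lift.{u + 1} κ ≤ #(branches ν μ.ord T)) :
    ∃ c : Finset Ordinal.{u} → Ordinal.{u}, IsColoring c κ 3 lam ∧
      ∀ τ < lam.ord, ∀ A B : Set Ordinal.{u}, A ⊆ Iio κ.ord → B ⊆ Iio κ.ord → Disjoint A B →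
        otp A = Ordinal.lift.{u + 1} lam.ord → otp B = Ordinal.lift.{u + 1} lam.ord →
        sSup A = sSup B →
        RestrictionWitnessesU ρ (A ∪ B) lam lam lam 3 →
        ∃ x ∈ tuples (A ∪ B) 3 \ (tuples A 3 ∪ tuples B 3), c x = τ := by
  obtain ⟨S, hSE, hS⟩ := hE
  obtain ⟨D, hDl, hD⟩ := hS.exists_walkColor hμ hlam hμlam hSE
  obtain ⟨ν, T, hKT, hκT⟩ := hT
  obtain ⟨N, node, hN, hcoh, hsep⟩ := hKT.exists_node hμ hκT
  set r : Ordinal.{u} → Ordinal.{u} → Ordinal.{u} := fun x y => ρ {x, y} with hrdef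
  have hr (x y) : r x y = r y x := by
    simp only [hrdef, Finset.pair_comm]
  -- The coloring chooses some value related to the set; `HasColor.unique` makes it the only one.
  -- Sets with no value get 0.
  set R : Finset Ordinal.{u} → Ordinal.{u} → Prop := fun s v =>
    ∃ o p q, s = {o, p, q} ∧ HasColor μ node r D o p q v with hR
  classical
  refine ⟨fun s => if h : ∃ v, R s v then h.choose else 0, fun s _ => ?_, ?_⟩
  · dsimp only
    split_ifs with h
    · obtain ⟨o, p, q, -, -, -, -, hc⟩ := h.choose_spec
      rw [← hc]
      exact hDl _ _ _
    · exact hlam.ord_pos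
  intro τ hτ A B hA hB hdisj hotpA hotpB _ ⟨π, hπ, hπX, hU⟩
  have hπκ (x) (hx : x < lam.ord) : π x < κ.ord := by
    have : π x ∈ A ∪ B := hπX ▸ mem_image_of_mem π hx
    exact this.elim (fun h => hA h) fun h => hB h
  -- Threads and ρ are transported along `π`, so that the search for a triple takes place below λ.
  have hnd : IsThreading μ.ord lam.ord fun x => node (π x) :=
    ⟨fun x hx y hy => hcoh _ (hπκ x hx) _ (hπκ y hy), fun x hx y hy hne =>
      hsep _ (hπκ x hx) _ (hπκ y hy) fun h => hne (hπ.injOn hx hy h)⟩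
  have hrl : ∀ x < lam.ord, ∀ y < lam.ord, x ≠ y → r (π x) (π y) < lam.ord := by
    intro x hx y hy hne
    refine hρ ⟨?_, Finset.card_pair fun h => hne (hπ.injOn hx hy h)⟩
    intro z hz
    simp only [Finset.coe_insert, Finset.coe_singleton, mem_insert_iff, mem_singleton_iff] at hz
    obtain rfl | rfl := hz
    · exact hπκ x hx
    · exact hπκ y hy
  have hU' : ∀ P' ⊆ Iio lam.ord, UnbddUnder lam.ord id P' → ∀ z : Ordinal.{u} → Ordinal.{u},
      (∀ ε < lam.ord, ε ≤ z ε ∧ z ε < lam.ord) → ∀ τ < lam.ord,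
        ∃ y ∈ P', ∃ ε < lam.ord, y < ε ∧ τ < r (π y) (π (z ε)) := by
    intro P' hP'l hP' z hz τ' hτ'
    obtain ⟨y, hy, ε, hε, hlt, h⟩ :=
      hU.exists_lt hlam (hμ.aleph0_le.trans_lt hμlam) hP'l hP' z hz hτ'
    refine ⟨y, hy, ε, hε, hlt, ?_⟩
    simpa only [Finset.image_insert, Finset.image_singleton] using h
  obtain ⟨o, p, q, hmem, hc⟩ := exists_mixed_hasColor hμ hlam hμlam hN hnd
    (r := fun x y => r (π x) (π y)) (fun x y => hr _ _) hrl (hD τ hτ)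
    (fun x hx => hx.1) (fun x hx => hx.1)
    (unbddUnder_of_otp hlam hπX subset_union_left hotpA)
    (unbddUnder_of_otp hlam hπX subset_union_right hotpB) hU'
  have hc' : HasColor μ node r D (π o) (π p) (π q) τ := hc
  have hpq : π p ≠ π q := by
    intro h
    have := hc'.1
    rw [h, splitLevel_self] at this
    exact not_lt_zero this
  have hAB (x y) (hx : x ∈ A) (hy : y ∈ B) : x ≠ y := hdisj.ne_of_mem hx hy
  refine ⟨{π o, π p, π q}, ⟨⟨?_, ?_⟩, ?_⟩, ?_⟩
  · intro x hx
    simp only [Finset.coe_insert, Finset.coe_singleton, mem_insert_iff, mem_singleton_iff] at hx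
    obtain ⟨⟨-, h1⟩, ⟨-, h2⟩, ⟨-, h3⟩⟩ | ⟨⟨-, h1⟩, ⟨-, h2⟩, ⟨-, h3⟩⟩ := hmem <;>
      obtain rfl | rfl | rfl := hx <;> simp [h1, h2, h3]
  · refine Finset.card_eq_three.2 ⟨_, _, _, ?_, ?_, hpq, rfl⟩ <;>
      obtain ⟨⟨-, h1⟩, ⟨-, h2⟩, ⟨-, h3⟩⟩ | ⟨⟨-, h1⟩, ⟨-, h2⟩, ⟨-, h3⟩⟩ := hmem
    exacts [hAB _ _ h1 h2, (hAB _ _ h2 h1).symm, hAB _ _ h1 h3, (hAB _ _ h3 h1).symm]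
  · have ho : π o ∈ (({π o, π p, π q} : Finset Ordinal.{u}) : Set Ordinal.{u}) := by simp
    have hp : π p ∈ (({π o, π p, π q} : Finset Ordinal.{u}) : Set Ordinal.{u}) := by simp
    obtain ⟨⟨-, h1⟩, ⟨-, h2⟩, -⟩ | ⟨⟨-, h1⟩, ⟨-, h2⟩, -⟩ := hmem
    · rintro (h | h)
      · exact hAB _ _ (h.1 hp) h2 rfl
      · exact hAB _ _ h1 (h.1 ho) rfl
    · rintro (h | h)
      · exact hAB _ _ (h.1 ho) h1 rfl
      · exact hAB _ _ h2 (h.1 hp) rfl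
  · have hex : ∃ v, R {π o, π p, π q} v := ⟨τ, _, _, _, rfl, hc'⟩
    dsimp only
    rw [dif_pos hex]
    obtain ⟨o', p', q', heq, h⟩ := hex.choose_spec
    exact h.unique hc' heq.symm
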